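/- Let $S_n$ act on $(\mathbb{C}^d)^{\otimes n}$ by $\pi(\sigma)(e_{i_1}\otimes\cdots\otimes e_{i_n}) = e_{i_{\sigma^{-1}(1)}}\otimes\cdots\otimes e_{i_{\sigma^{-1}(n)}}$, and for $f=\sum_\sigma c_\sigma\sigma\in\mathbb{C}[S_n]$ put $\tilde\pi(f)=\sum_\sigma c_\sigma\pi(\sigma)$. Call $f$ $k$-local if $c_\sigma\neq 0$ only for permutations $\sigma$ that move at most $k$ points. For a standard Young tableau $T$ with $n$ boxes, a Young basis vector $|v_T\rangle$ is a unit vector of $(\mathbb{C}^d)^{\otimes n}$ on which each Young–Jucys–Murphy element $X_i=\sum_{j<i}(j\,i)$, $1\le i\le n$, acts as multiplication by the content (column minus row) of the box of $T$ containing $i$. Circuits act on the $n$ qudits together with finitely many ancilla qubits. A circuit is a finite sequence of gates of two kinds: unitaries on the ancilla register alone (not counted), and SWAP gates on the data qudits, where the two sites to be swapped may be selected by the computational basis state of the ancillas, i.e. $\sum_a \mathrm{SWAP}_{i(a),j(a)}\otimes|a\rangle\langle a|$ (with $\mathrm{SWAP}_{i,i}=1$); each such gate counts as one SWAP gate. The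 amplitude of a circuit with unitary $W$ from $|v\rangle$ to $|v'\rangle$ is $\langle v'|\langle 0|\,W\,|v\rangle|0\rangle$, where $|0\rangle$ is the all-zero ancilla state. **Theorem.** There is a universal constant $A>0$ such that the following holds. Let $n,d,k\ge 0$ be integers, let $f=\sum_\sigma c_\sigma\sigma\in\mathbb{C}[S_n]$ be $k$-local with $H=\tilde\pi(f)$ Hermitian on $(\mathbb{C}^d)^{\otimes n}$, and let $C=\max_\sigma|c_\sigma|$. Let $t\in\mathbb{R}$ and $\varepsilon>0$ be such that $tCkn^k\ge 1$ and $tCkn^k/\varepsilon>e$. Then there is a circuit, depending on $n,d,k,f,t,\varepsilon$ but not on the input or output states, with at most $$A\; t\,C\,k^3 n^k\,\frac{\log(tCkn^k/\varepsilon)}{\log\log(tCkn^k/\varepsilon)}$$ SWAP gates, such that for all standard Young tableaux $T,T'$ with $n$ boxes and all Young basis vectors $|v_T\rangle,|v_{T'}\rangle$ the amplitude of the circuit from $|v_T\rangle$ to $|v_{T'}\rangle$ differs from the matrix element $\langle v_{T'}|\exp(-itH)|v_T\rangle$ by at most $\varepsilon$. Moreover, this matrix element is exactly $0$ whenever $T$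 and $T'$ have different shapes. -/

import Mathlib

open scoped Kronecker

namespace PermQudit

noncomputable section

/-! ### The permutation representation on `n` qudits -/

/-- Labels `(i₁, …, iₙ)` of the computational basis vectors `e_{i₁} ⊗ ⋯ ⊗ e_{iₙ}` of
`(ℂ^d)^{⊗ n}`. Vectors of `(ℂ^d)^{⊗ n}` are given by their coordinates `Config n d → ℂ`. -/
abbrev Config (n d : ℕ) : Type := Fin n → Fin d

/-- The operator `π(σ)`, with `π(σ) e_x = e_{x ∘ σ⁻¹}`: it moves the content of site `i` to
site `σ i`. -/
def permOp {n : ℕ} (d : ℕ) (σ : Equiv.Perm (Fin n)) :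
    Matrix (Config n d) (Config n d) ℂ :=
  Matrix.of fun y x => if y = x ∘ σ.symm then 1 else 0

/-- The representation `π̃(f) = ∑ c_σ π(σ)` of `f = ∑ c_σ σ ∈ ℂ[S_n]`. -/
def piTilde {n : ℕ} (d : ℕ) (f : MonoidAlgebra ℂ (Equiv.Perm (Fin n))) :
    Matrix (Config n d) (Config n d) ℂ :=
  ∑ σ : Equiv.Perm (Fin n), f.coeff σ • permOp d σ

/-- `f` is `k`-local: it only contains permutations that move at most `k` sites. -/
def IsLocal {n : ℕ} (k : ℕ) (f : MonoidAlgebra ℂ (Equiv.Perm (Fin n))) : Prop :=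
  ∀ σ : Equiv.Perm (Fin n), f.coeff σ ≠ 0 → σ.support.card ≤ k

/-- The constant `C = max_σ |c_σ|`. -/
def maxCoeff {n : ℕ} (f : MonoidAlgebra ℂ (Equiv.Perm (Fin n))) : ℝ :=
  ⨆ σ : Equiv.Perm (Fin n), ‖f.coeff σ‖

/-- The time evolution `exp(-itH)`. -/
def evolution {n d : ℕ} (H : Matrix (Config n d) (Config n d) ℂ) (t : ℝ) :
    Matrix (Config n d) (Config n d) ℂ :=
  NormedSpace.exp ((-(Complex.I * (t : ℂ))) • H)

/-- The matrix element `⟨w|A|v⟩`. -/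
def matrixElement {ι : Type} [Fintype ι] (w : ι → ℂ) (A : Matrix ι ι ℂ) (v : ι → ℂ) : ℂ :=
  star w ⬝ᵥ (A.mulVec v)

/-! ### Young basis vectors -/

/-- A standard Young tableau with `n` boxes: a Young diagram together with the positions
`(row, column)` of the entries; entries increase along rows and down columns. -/
structure StdTableau (n : ℕ) where
  shape : YoungDiagram
  pos : Fin n ≃ shape.cells
  row_lt : ∀ i j : Fin n, (pos i).1.1 = (pos j).1.1 → (pos i).1.2 < (pos j).1.2 → i < j
  col_lt : ∀ i j : Fin n, (pos i).1.2 = (pos j).1.2 → (pos i).1.1 < (pos j).1.1 → i < j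

/-- The content vector: column minus row of the box that contains `i`. -/
def StdTableau.content {n : ℕ} (T : StdTableau n) (i : Fin n) : ℤ :=
  ((T.pos i).1.2 : ℤ) - ((T.pos i).1.1 : ℤ)

/-- The Young-Jucys-Murphy element `X_k = ∑_{i < k} (i, k)`. -/
def yjm {n : ℕ} (k : Fin n) : MonoidAlgebra ℂ (Equiv.Perm (Fin n)) :=
  ∑ i ∈ Finset.Iio k, MonoidAlgebra.single (Equiv.swap i k) 1

/-- `v` is a (normalised) Young basis vector `|v_T⟩` of `(ℂ^d)^{⊗ n}`: a unit vector on which every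
YJM element acts by the content of the tableau `T`. -/
def IsYoungVector {n d : ℕ} (T : StdTableau n) (v : Config n d → ℂ) : Prop :=
  star v ⬝ᵥ v = 1 ∧
    ∀ i : Fin n, (piTilde d (yjm i)).mulVec v = (T.content i : ℂ) • v

/-! ### Circuits with ancilla-selected SWAP gates -/

/-- Labels of the computational basis of a register of `m` ancilla qubits. -/
abbrev Anc (m : ℕ) : Type := Fin m → Fin 2

/-- The gates on `n` qudits and `m` ancilla qubits.
* `ancilla U`: a unitary on the ancilla register only.
* `swap i j`: a SWAP gate on the qudits whose two sites are selected by the computational basis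
state of the ancilla register, `∑_a SWAP_{i(a), j(a)} ⊗ |a⟩⟨a|`. On the branches with `i(a) = j(a)`
nothing is swapped, so ordinary SWAP gates and controlled SWAP gates are special cases. -/
inductive Gate (n m : ℕ) where
  | ancilla (U : Matrix.unitaryGroup (Anc m) ℂ) : Gate n m
  | swap (i j : Anc m → Fin n) : Gate n m

/-- The unitary matrix of a gate on the joint system of qudits and ancillas. -/
def Gate.toMatrix {n m : ℕ} (d : ℕ) :
    Gate n m → Matrix (Config n d × Anc m) (Config n d × Anc m) ℂ
  | .ancilla U => (1 : Matrix (Config n d) (Config n d) ℂ) ⊗ₖ (U : Matrix (Anc m) (Anc m) ℂ)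
  | .swap i j => Matrix.blockDiagonal fun a => permOp d (Equiv.swap (i a) (j a))

/-- A circuit is a list of gates, the head of the list is applied first. -/
abbrev Circuit (n m : ℕ) : Type := List (Gate n m)

/-- The unitary matrix of a circuit. -/
def Circuit.toMatrix {n m : ℕ} (d : ℕ) :
    Circuit n m → Matrix (Config n d × Anc m) (Config n d × Anc m) ℂ
  | [] => 1
  | g :: c => Circuit.toMatrix d c * g.toMatrix d

/-- The number of SWAP gates of a circuit. -/
def Circuit.swapCount {n m : ℕ} : Circuit n m → ℕ
  | [] => 0
  | .ancilla _ :: c => Circuit.swapCount c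
  | .swap _ _ :: c => Circuit.swapCount c + 1

/-- The state `|v⟩ ⊗ |0⟩` with all ancilla qubits in state `0`. -/
def withZeroAnc {n d : ℕ} (m : ℕ) (v : Config n d → ℂ) : Config n d × Anc m → ℂ :=
  fun p => if p.2 = 0 then v p.1 else 0

/-- The amplitude `(⟨w| ⊗ ⟨0|) W (|v⟩ ⊗ |0⟩)` of a circuit with unitary `W`. -/
def Circuit.amplitude {n m d : ℕ} (c : Circuit n m) (w v : Config n d → ℂ) : ℂ :=
  matrixElement (withZeroAnc m w) (Circuit.toMatrix d c) (withZeroAnc m v)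

end

end PermQudit

/-!
The circuit simulates `H = π̃(f)` by a truncated Taylor series. By a count of the permutations that
move at most `k` sites (`card_filter_card_support_le`), the coefficients of `f` have total modulus
at most `C n^k`, and each permutation in `f` is a product of `k` transpositions. The time is cut into
`r = ⌈2τ⌉` steps, `τ = t C k n^k`, so that in one step the exponential series truncated after `N`
terms is a linear combination, of total modulus at most `2`, of products of `N k` transpositions
(`IsSwapCombination`). Preparing the square roots of the coefficients in the ancillas and selecting
the permutation with `N k` SWAP gates block-encodes half of this operator `V`
(`IsSwapCombination.exists_circuit`), and one step of oblivious amplitude amplification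
(`amplification_identity`) removes the factor `1 / 2`, since `V` is nearly unitary. A block encoding
of a near unitary leaks little amplitude (`sq_norm_mul_sub_mul_le`), so that the steps can share the
ancillas, and the total error is at most `r √(20 / N!)`. With `L = log (τ / ε)` a choice
`N ≤ 17 L / log L` makes `N!` at least `exp (8 L)` (`exists_factorial_ge`), hence the error at
most `ε`, with `3 r N k` SWAP gates in total.

For the vanishing of matrix elements, `∏_i (x - X_i)` in the Young-Jucys-Murphy elements commutes
with all permutations (`commute_prod_jmFactor`, from the relations of the degenerate affine Hecke
algebra), hence with `exp(-itH)`. On a Young vector it acts by `∏_i (x - c_i)`, so a nonzero matrix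
element forces equal multisets of contents, and these determine the shape because the diagonals of a
Young diagram are initial segments of chains (`le_of_card_diagonalCells_le`).
-/

namespace PermQudit

/-! ### The permutation operators -/

lemma permOp_one {n d : ℕ} : permOp d (1 : Equiv.Perm (Fin n)) = 1 := by
  ext y x
  simp [permOp, Matrix.one_apply, Equiv.Perm.one_def]

lemma permOp_mul {n d : ℕ} (σ τ : Equiv.Perm (Fin n)) :
    permOp d (σ * τ) = permOp d σ * permOp d τ := by
  ext y x
  simp only [permOp, Matrix.mul_apply, Matrix.of_apply, mul_ite, mul_one, mul_zero]
  rw [Finset.sum_ite_eq' Finset.univ (x ∘ τ.symm)]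
  simp [Equiv.Perm.mul_def, Function.comp_assoc]
  congr

lemma permOp_conjTranspose {n d : ℕ} (σ : Equiv.Perm (Fin n)) :
    (permOp d σ).conjTranspose = permOp d σ⁻¹ := by
  ext y x
  have : x = y ∘ σ.symm ↔ y = x ∘ σ := by
    constructor
    · rintro rfl; ext; simp
    · rintro rfl; ext; simp
  simp only [permOp, Matrix.conjTranspose_apply, Matrix.of_apply, this]
  simp only [Equiv.Perm.inv_def, Equiv.symm_symm]
  split_ifs <;> simp

/-- The permutation representation `π` as a homomorphism of monoids. -/
def permHom (n d : ℕ) : Equiv.Perm (Fin n) →* Matrix (Config n d) (Config n d) ℂ where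
  toFun := permOp d
  map_one' := permOp_one
  map_mul' := permOp_mul

lemma permHom_apply {n d : ℕ} (σ : Equiv.Perm (Fin n)) : permHom n d σ = permOp d σ := rfl

/-! ### Symmetric functions of the Young-Jucys-Murphy elements -/

section YJM

variable {n : ℕ} {A : Type*} [Ring A] (ρ : Equiv.Perm (Fin n) →* A)

/-- The image `∑_{i < k} ρ (i k)` of the Young-Jucys-Murphy element `X_k` under `ρ`. -/
def jucysMurphy (k : Fin n) : A := ∑ i ∈ Finset.Iio k, ρ (Equiv.swap i k)

lemma commute_swap_jucysMurphy {a b k : Fin n} (ha : a ≠ k) (hb : b ≠ k) (h : a < k ↔ b < k) :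
    Commute (ρ (Equiv.swap a b)) (jucysMurphy ρ k) := by
  unfold Commute SemiconjBy jucysMurphy
  rw [Finset.mul_sum, Finset.sum_mul]
  refine Finset.sum_bij' (fun i _ => Equiv.swap a b i) (fun i _ => Equiv.swap a b i) ?_ ?_ ?_ ?_ ?_
  · intro i hi
    rw [Finset.mem_Iio] at hi ⊢
    rw [Equiv.swap_apply_def]
    split_ifs with h1 h2
    · subst h1; tauto
    · subst h2; tauto
    · exact hi
  · intro i hi
    rw [Finset.mem_Iio] at hi ⊢
    rw [Equiv.swap_apply_def]
    split_ifs with h1 h2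
    · subst h1; tauto
    · subst h2; tauto
    · exact hi
  · intro i _; simp
  · intro i _; simp
  · intro i _
    rw [← map_mul, ← map_mul, Equiv.mul_swap_eq_swap_mul,
      Equiv.swap_apply_of_ne_of_ne ha.symm hb.symm]

lemma commute_jucysMurphy {i k : Fin n} (h : i < k) :
    Commute (jucysMurphy ρ i) (jucysMurphy ρ k) := by
  refine Commute.sum_left _ _ _ fun a ha => ?_
  rw [Finset.mem_Iio] at ha
  exact commute_swap_jucysMurphy ρ (ha.trans h).ne h.ne (by simp [ha.trans h, h])

/-- The relation `s X_i + 1 = X_{i+1} s` of the degenerate affine Hecke algebra, `s = (i i+1)`. -/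
lemma swap_mul_jucysMurphy {i j : Fin n} (h : (j : ℕ) = i + 1) :
    ρ (Equiv.swap i j) * jucysMurphy ρ i + 1 = jucysMurphy ρ j * ρ (Equiv.swap i j) := by
  have hI : Finset.Iio j = insert i (Finset.Iio i) := by
    ext a
    simp only [Finset.mem_Iio, Finset.mem_insert, Fin.lt_def, Fin.ext_iff]
    omega
  unfold jucysMurphy
  rw [hI, Finset.sum_insert (by simp), add_mul, ← map_mul, Equiv.swap_mul_self, map_one, add_comm,
    Finset.mul_sum, Finset.sum_mul]
  congr 1
  refine Finset.sum_congr rfl fun a ha => ?_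
  rw [Finset.mem_Iio] at ha
  have haj : a ≠ j := by rw [Ne, Fin.ext_iff]; rw [Fin.lt_def] at ha; omega
  rw [← map_mul, ← map_mul, Equiv.mul_swap_eq_swap_mul, Equiv.swap_apply_left,
    Equiv.swap_apply_of_ne_of_ne ha.ne haj]

lemma jucysMurphy_mul_swap {i j : Fin n} (h : (j : ℕ) = i + 1) :
    jucysMurphy ρ i * ρ (Equiv.swap i j) + 1 = ρ (Equiv.swap i j) * jucysMurphy ρ j := by
  have hs : ρ (Equiv.swap i j) * ρ (Equiv.swap i j) = 1 := by
    rw [← map_mul, Equiv.swap_mul_self, map_one]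
  have := congrArg (fun z => ρ (Equiv.swap i j) * z * ρ (Equiv.swap i j))
    (swap_mul_jucysMurphy ρ h)
  simp only [mul_add, add_mul, mul_one, mul_assoc, hs] at this
  rwa [← mul_assoc _ _ (_ * _), hs, one_mul] at this

/-- The product of two consecutive factors `(x - X_i) (x - X_{i+1})` is fixed by `(i i+1)`. -/
lemma commute_swap_mul_sub_jucysMurphy {i j : Fin n} (h : (j : ℕ) = i + 1) {x : A}
    (hx : ∀ a, Commute x a) :
    Commute (ρ (Equiv.swap i j)) ((x - jucysMurphy ρ i) * (x - jucysMurphy ρ j)) := by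
  have hij : i < j := by rw [Fin.lt_def]; omega
  set s := ρ (Equiv.swap i j)
  set a := jucysMurphy ρ i
  set b := jucysMurphy ρ j
  have h1 : s * a + 1 = b * s := swap_mul_jucysMurphy ρ h
  have h2 : a * s + 1 = s * b := jucysMurphy_mul_swap ρ h
  have h3 : a * b = b * a := commute_jucysMurphy ρ hij
  have hsum : Commute s (a + b) := by
    unfold Commute SemiconjBy
    rw [mul_add, add_mul, ← h1, ← h2]; abel
  have hprod : Commute s (a * b) := by
    unfold Commute SemiconjBy
    calc s * (a * b) = (s * a + 1) * b - b := by noncomm_ring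
      _ = b * (s * b) - b := by rw [h1]; noncomm_ring
      _ = b * a * s := by rw [← h2]; noncomm_ring
      _ = a * b * s := by rw [h3]
  have hx' := (hx a).eq
  have : (x - a) * (x - b) = x * x - x * (a + b) + a * b := by
    rw [sub_mul, mul_sub, mul_sub, mul_add, ← hx']; abel
  rw [this]
  exact ((((hx s).symm.mul_right (hx s).symm).sub_right ((hx s).symm.mul_right hsum))).add_right
    hprod

/-- The factor `x - X_m` for `m < n`, and `1` for larger `m`. -/
def jmFactor (x : A) (m : ℕ) : A := if h : m < n then x - jucysMurphy ρ ⟨m, h⟩ else 1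

/-- The generating function `∏_i (x - X_i)` of the elementary symmetric polynomials of the
Young-Jucys-Murphy elements is central. -/
lemma commute_prod_jmFactor {x : A} (hx : ∀ a, Commute x a) (σ : Equiv.Perm (Fin n)) :
    Commute (ρ σ) ((List.range n).map (jmFactor ρ x)).prod := by
  -- For an adjacent transposition `(i j)` only the factors `i` and `j` matter.
  have key : ∀ i j : Fin n, (j : ℕ) = i + 1 →
      Commute (ρ (Equiv.swap i j)) ((List.range n).map (jmFactor ρ x)).prod := by
    intro i j hij
    have hj := j.2
    have hcomm : ∀ m : ℕ, m ≠ i → m ≠ j →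
        Commute (ρ (Equiv.swap i j)) (jmFactor ρ x m) := by
      intro m hi hj
      unfold jmFactor
      split_ifs with hm
      · refine (hx _).symm.sub_right (commute_swap_jucysMurphy ρ ?_ ?_ ?_)
        · rw [Ne, Fin.ext_iff]; exact fun h => hi h.symm
        · rw [Ne, Fin.ext_iff]; exact fun h => hj h.symm
        · simp only [Fin.lt_def]; omega
      · exact Commute.one_right _
    have hlow : ∀ m : ℕ, m ≤ i →
        Commute (ρ (Equiv.swap i j)) ((List.range m).map (jmFactor ρ x)).prod := by
      intro m hm
      induction m with
      | zero => simp
      | succ m ih =>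
        rw [List.prod_range_succ]
        exact (ih (by omega)).mul_right (hcomm m (by omega) (by omega))
    have hhigh : ∀ m : ℕ, (i : ℕ) + 2 ≤ m →
        Commute (ρ (Equiv.swap i j)) ((List.range m).map (jmFactor ρ x)).prod := by
      intro m hm
      induction m, hm using Nat.le_induction with
      | base =>
        rw [List.prod_range_succ, List.prod_range_succ, mul_assoc]
        refine (hlow i le_rfl).mul_right ?_
        have := commute_swap_mul_sub_jucysMurphy ρ hij hx
        have e : (⟨(i : ℕ) + 1, by omega⟩ : Fin n) = j := Fin.ext hij.symm
        unfold jmFactor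
        rw [dif_pos i.2, dif_pos (by omega), e]
        exact this
      | succ m hm ih =>
        rw [List.prod_range_succ]
        exact ih.mul_right (hcomm m (by omega) (by omega))
    exact hhigh n (by omega)
  rcases n with _ | n
  · rw [Subsingleton.elim σ 1, map_one]; exact Commute.one_left _
  · have hσ : σ ∈ Submonoid.closure
        (Set.range fun i : Fin n => Equiv.swap i.castSucc i.succ) := by
      rw [Equiv.Perm.mclosure_swap_castSucc_succ]; trivial
    induction hσ using Submonoid.closure_induction with
    | mem τ hτ =>
      obtain ⟨i, rfl⟩ := hτ
      exact key _ _ (by simp)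
    | one => rw [map_one]; exact Commute.one_left _
    | mul a b _ _ ha hb => rw [map_mul]; exact ha.mul_left hb

end YJM

/-! ### Contents determine the shape -/

/-- The cells of a Young diagram on the diagonal of content `z`. -/
def diagonalCells (μ : YoungDiagram) (z : ℤ) : Finset (ℕ × ℕ) :=
  μ.cells.filter fun p => (p.2 : ℤ) - (p.1 : ℤ) = z

/-- The diagonals of a Young diagram are initial segments of chains, so their lengths determine
the diagram. -/
lemma le_of_card_diagonalCells_le {μ ν : YoungDiagram}
    (h : ∀ z, (diagonalCells μ z).card ≤ (diagonalCells ν z).card) : μ ≤ ν := by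
  rintro ⟨i, j⟩ hp
  by_contra hn
  have hp' : (i, j) ∈ μ := hp
  have hn' : (i, j) ∉ ν := hn
  refine absurd (h ((j : ℤ) - i)) (not_le.2 (Finset.card_lt_card ?_))
  rw [Finset.ssubset_iff_of_subset]
  · exact ⟨(i, j), by simp [diagonalCells, hp'], by simp [diagonalCells, hn']⟩
  · rintro ⟨a, b⟩ hab
    simp only [diagonalCells, Finset.mem_filter, YoungDiagram.mem_cells] at hab ⊢
    refine ⟨?_, hab.2⟩
    have hai : a < i := by
      by_contra hc
      exact hn' (ν.up_left_mem (by omega) (by omega) hab.1)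
    exact μ.up_left_mem hai.le (by omega) hp'

lemma StdTableau.card_diagonalCells {n : ℕ} (T : StdTableau n) (z : ℤ) :
    (diagonalCells T.shape z).card = (Finset.univ.val.map T.content).count z := by
  rw [Multiset.count_map, ← Finset.filter_val, Finset.card_val]
  symm
  refine Finset.card_bij (fun i _ => (T.pos i).1) ?_ ?_ ?_
  · intro i hi
    simp only [Finset.mem_filter] at hi
    exact Finset.mem_filter.2 ⟨(T.pos i).2, hi.2.symm⟩
  · intro a _ b _ h
    exact T.pos.injective (Subtype.ext h)
  · intro p hp
    have hp := Finset.mem_filter.1 hp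
    refine ⟨T.pos.symm ⟨p, hp.1⟩, ?_, by simp⟩
    refine Finset.mem_filter.2 ⟨Finset.mem_univ _, ?_⟩
    simp only [StdTableau.content, Equiv.apply_symm_apply]
    exact hp.2.symm

lemma StdTableau.shape_eq_of_content {n : ℕ} {T T' : StdTableau n}
    (h : Finset.univ.val.map T.content = Finset.univ.val.map T'.content) : T.shape = T'.shape :=
  le_antisymm
    (le_of_card_diagonalCells_le fun z => by rw [T.card_diagonalCells, T'.card_diagonalCells, h])
    (le_of_card_diagonalCells_le fun z => by rw [T.card_diagonalCells, T'.card_diagonalCells, h])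

/-! ### Vanishing of matrix elements between different shapes -/

lemma piTilde_yjm {n d : ℕ} (k : Fin n) : piTilde d (yjm k) = jucysMurphy (permHom n d) k := by
  unfold piTilde yjm jucysMurphy
  simp only [MonoidAlgebra.coeff_sum, MonoidAlgebra.coeff_single, Finset.sum_apply',
    Finset.sum_smul]
  rw [Finset.sum_comm]
  refine Finset.sum_congr rfl fun i _ => ?_
  rw [Finset.sum_eq_single (Equiv.swap i k)]
  · simp [permHom_apply]
  · intro b _ hb; simp [hb.symm]
  · simp

lemma jucysMurphy_conjTranspose {n d : ℕ} (k : Fin n) :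
    (jucysMurphy (permHom n d) k).conjTranspose = jucysMurphy (permHom n d) k := by
  simp [jucysMurphy, Matrix.conjTranspose_sum, permHom_apply, permOp_conjTranspose]

lemma IsYoungVector.mulVec_prod {n d : ℕ} {T : StdTableau n} {v : Config n d → ℂ}
    (hv : IsYoungVector T v) (x : ℂ) :
    ((List.range n).map (jmFactor (permHom n d) (x • 1))).prod.mulVec v =
      (∏ i : Fin n, (x - T.content i)) • v := by
  have : ∀ m : ℕ, ((List.range m).map (jmFactor (permHom n d) (x • 1))).prod.mulVec v =
      (∏ i ∈ Finset.range m, if h : i < n then (x - T.content ⟨i, h⟩) else 1) • v := by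
    intro m
    induction m with
    | zero => simp
    | succ m ih =>
      have : (jmFactor (permHom n d) (x • 1) m).mulVec v =
          (if h : m < n then (x - T.content ⟨m, h⟩) else 1) • v := by
        unfold jmFactor
        split_ifs with h
        · rw [Matrix.sub_mulVec, ← piTilde_yjm, hv.2, Matrix.smul_mulVec, Matrix.one_mulVec,
            sub_smul]
        · simp
      rw [List.prod_range_succ, ← Matrix.mulVec_mulVec, this, Matrix.mulVec_smul, ih,
        Finset.prod_range_succ, smul_smul, mul_comm]
  rw [this n, Finset.prod_range]
  simp

lemma IsYoungVector.star_vecMul_prod {n d : ℕ} {T : StdTableau n} {v : Config n d → ℂ}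
    (hv : IsYoungVector T v) (x : ℂ) :
    Matrix.vecMul (star v) ((List.range n).map (jmFactor (permHom n d) (x • 1))).prod =
      (∏ i : Fin n, (x - T.content i)) • star v := by
  have : ∀ m : ℕ, Matrix.vecMul (star v)
        ((List.range m).map (jmFactor (permHom n d) (x • 1))).prod =
      (∏ i ∈ Finset.range m, if h : i < n then (x - T.content ⟨i, h⟩) else 1) • star v := by
    intro m
    induction m with
    | zero => simp
    | succ m ih =>
      have : Matrix.vecMul (star v) (jmFactor (permHom n d) (x • 1) m) =
          (if h : m < n then (x - T.content ⟨m, h⟩) else 1) • star v := by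
        unfold jmFactor
        split_ifs with h
        · rw [Matrix.vecMul_sub, ← jucysMurphy_conjTranspose, ← Matrix.star_mulVec,
            ← piTilde_yjm, hv.2, Matrix.vecMul_smul, Matrix.vecMul_one, sub_smul]
          simp
        · simp
      rw [List.prod_range_succ, ← Matrix.vecMul_vecMul, ih, Matrix.smul_vecMul, this,
        Finset.prod_range_succ, smul_smul]
  rw [this n, Finset.prod_range]
  simp

/-- If `E` commutes with the commutant of `π(S_n)`, then it has no matrix element between Young
vectors of different shapes: for every `x` it commutes with `∏_i (x - X_i)`, whose eigenvalues
`∏_i (x - c_i)` on the two vectors can agree for all `x` only if the contents do. -/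
lemma matrixElement_eq_zero {n d : ℕ} {T T' : StdTableau n} {v v' : Config n d → ℂ}
    (hv : IsYoungVector T v) (hv' : IsYoungVector T' v') (hT : T.shape ≠ T'.shape)
    {E : Matrix (Config n d) (Config n d) ℂ}
    (hE : ∀ Z, (∀ σ, Commute (permOp d σ) Z) → Commute E Z) : matrixElement v' E v = 0 := by
  by_contra h0
  refine hT (StdTableau.shape_eq_of_content ?_)
  have hx : ∀ x : ℂ, ∏ i : Fin n, (x - T.content i) = ∏ i : Fin n, (x - T'.content i) := by
    intro x
    set Z := ((List.range n).map (jmFactor (permHom n d) (x • 1))).prod with hZ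
    have hc : Commute E Z := hE Z fun σ =>
      commute_prod_jmFactor (permHom n d)
        (fun a => by simp [Commute, SemiconjBy]) σ
    have h1 : star v' ⬝ᵥ (E * Z).mulVec v = (∏ i : Fin n, (x - T.content i)) *
        matrixElement v' E v := by
      rw [← Matrix.mulVec_mulVec, hv.mulVec_prod, Matrix.mulVec_smul, dotProduct_smul, smul_eq_mul,
        matrixElement]
    have h2 : star v' ⬝ᵥ (Z * E).mulVec v = (∏ i : Fin n, (x - T'.content i)) *
        matrixElement v' E v := by
      rw [← Matrix.mulVec_mulVec, Matrix.dotProduct_mulVec, hv'.star_vecMul_prod, smul_dotProduct,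
        smul_eq_mul, matrixElement]
    rw [hc.eq, h2] at h1
    exact (mul_right_cancel₀ h0 h1).symm
  have hp : (Multiset.map (fun a => Polynomial.X - Polynomial.C a)
        (Finset.univ.val.map fun i => (T.content i : ℂ))).prod =
      (Multiset.map (fun a => Polynomial.X - Polynomial.C a)
        (Finset.univ.val.map fun i => (T'.content i : ℂ))).prod := by
    refine Polynomial.funext fun x => ?_
    have e : ∀ c : Fin n → ℂ, (Multiset.map (fun a => Polynomial.X - Polynomial.C a)
        (Finset.univ.val.map c)).prod = ∏ i, (Polynomial.X - Polynomial.C (c i)) := by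
      intro c; rw [Multiset.map_map]; rfl
    rw [e, e]
    simpa [Polynomial.eval_prod] using hx x
  have hr := congrArg Polynomial.roots hp
  rw [Polynomial.roots_multiset_prod_X_sub_C, Polynomial.roots_multiset_prod_X_sub_C] at hr
  refine Multiset.map_injective (Int.cast_injective (α := ℂ)) ?_
  simpa [Multiset.map_map, Function.comp_def] using hr

open scoped Pointwise Matrix.Norms.L2Operator Nat

/-! ### Permutations as products of transpositions -/

/-- The transpositions together with the identity, which occurs as `swap i i`. The permutations in
`swapSet n ^ q` are those that `q` SWAP gates can realise. -/
def swapSet (n : ℕ) : Set (Equiv.Perm (Fin n)) := {σ | ∃ i j, σ = Equiv.swap i j}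

lemma one_mem_swapSet {n : ℕ} [NeZero n] : (1 : Equiv.Perm (Fin n)) ∈ swapSet n :=
  ⟨0, 0, (Equiv.swap_self 0).symm⟩

lemma one_mem_swapSet_pow {n : ℕ} [NeZero n] (q : ℕ) :
    (1 : Equiv.Perm (Fin n)) ∈ swapSet n ^ q := by
  simpa using Set.pow_mem_pow (one_mem_swapSet (n := n)) (n := q)

lemma mem_swapSet_pow_of_card_support_le {n : ℕ} [NeZero n] {k : ℕ} {σ : Equiv.Perm (Fin n)}
    (h : σ.support.card ≤ k) : σ ∈ swapSet n ^ k := by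
  induction k generalizing σ with
  | zero =>
    have : σ = 1 := by simpa using h
    simp [this]
  | succ k ih =>
    by_cases hσ : σ = 1
    · rw [hσ]
      exact one_mem_swapSet_pow _
    · obtain ⟨x, hx⟩ : ∃ x, σ x ≠ x := by
        by_contra hc
        push Not at hc
        exact hσ (Equiv.ext hc)
      have hlt := Equiv.Perm.card_support_swap_mul hx
      rw [pow_succ']
      refine ⟨Equiv.swap x (σ x), ⟨x, σ x, rfl⟩, _, ih (σ := Equiv.swap x (σ x) * σ) (by omega), ?_⟩
      simp

lemma card_support_subset {n : ℕ} (S : Finset (Fin n)) :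
    (Finset.univ.filter fun σ : Equiv.Perm (Fin n) => σ.support ⊆ S).card = S.card ! := by
  have h := Fintype.card_congr (Equiv.Perm.subtypeEquivSubtypePerm fun a => a ∈ S)
  rw [Fintype.card_perm, Fintype.card_coe] at h
  rw [h, ← Fintype.card_subtype]
  refine Fintype.card_congr (Equiv.subtypeEquivRight fun σ => ?_)
  refine forall_congr' fun a => ?_
  rw [Equiv.Perm.mem_support]
  tauto

/-- At most `n ^ k` permutations of `n` points move at most `k` points. -/
lemma card_filter_card_support_le {n : ℕ} (hn : 1 ≤ n) (k : ℕ) :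
    (Finset.univ.filter fun σ : Equiv.Perm (Fin n) => σ.support.card ≤ k).card ≤ n ^ k := by
  -- The support of such a permutation extends to a set of exactly `min k n` points.
  set m := min k n
  calc _ ≤ ((Finset.powersetCard m (Finset.univ : Finset (Fin n))).biUnion fun S =>
        Finset.univ.filter fun σ : Equiv.Perm (Fin n) => σ.support ⊆ S).card := by
        refine Finset.card_le_card fun σ hσ => ?_
        have hσ := (Finset.mem_filter.1 hσ).2
        have hσn : σ.support.card ≤ n := by simpa using Finset.card_le_univ σ.support
        obtain ⟨S, hS, hc⟩ := Finset.exists_superset_card_eq (s := σ.support) (n := m)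
          (le_min hσ hσn) (by simp [m])
        exact Finset.mem_biUnion.2 ⟨S, by simp [Finset.mem_powersetCard, hc], by simpa using hS⟩
    _ ≤ (Finset.powersetCard m (Finset.univ : Finset (Fin n))).card * m ! := by
        refine Finset.card_biUnion_le_card_mul _ _ _ fun S hS => ?_
        rw [card_support_subset, (Finset.mem_powersetCard.1 hS).2]
    _ = n.descFactorial m := by
        rw [Finset.card_powersetCard, Finset.card_univ, Fintype.card_fin,
          Nat.descFactorial_eq_factorial_mul_choose, mul_comm]
    _ ≤ n ^ m := Nat.descFactorial_le_pow n m
    _ ≤ n ^ k := Nat.pow_le_pow_right hn (min_le_left _ _)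

/-! ### Linear combinations of short products of transpositions -/

/-- `V` is a linear combination, with coefficients of total modulus `s`, of permutation operators
that are products of `q` transpositions. -/
def IsSwapCombination {n d : ℕ} (q : ℕ) (s : ℝ) (V : Matrix (Config n d) (Config n d) ℂ) : Prop :=
  ∃ (L : Type) (_ : Fintype L) (c : L → ℂ) (σ : L → Equiv.Perm (Fin n)),
    (∀ l, σ l ∈ swapSet n ^ q) ∧ ∑ l, ‖c l‖ = s ∧ V = ∑ l, c l • permOp d (σ l)

namespace IsSwapCombination

variable {n d : ℕ} {q q' : ℕ} {s s' : ℝ} {V V' : Matrix (Config n d) (Config n d) ℂ}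

lemma zero (q : ℕ) : IsSwapCombination q 0 (0 : Matrix (Config n d) (Config n d) ℂ) :=
  ⟨Empty, inferInstance, Empty.elim, Empty.elim, fun l => l.elim, by simp, by simp⟩

lemma one : IsSwapCombination 0 1 (1 : Matrix (Config n d) (Config n d) ℂ) :=
  ⟨Unit, inferInstance, fun _ => 1, fun _ => 1, by simp, by simp, by simp [permOp_one]⟩

lemma mono [NeZero n] (h : IsSwapCombination q s V) (hq : q ≤ q') : IsSwapCombination q' s V := by
  obtain ⟨L, _, c, σ, hσ, hc, hV⟩ := h
  exact ⟨L, inferInstance, c, σ,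
    fun l => Set.pow_subset_pow_right one_mem_swapSet hq (hσ l), hc, hV⟩

lemma smul (a : ℂ) (h : IsSwapCombination q s V) : IsSwapCombination q (‖a‖ * s) (a • V) := by
  obtain ⟨L, _, c, σ, hσ, hc, hV⟩ := h
  exact ⟨L, inferInstance, fun l => a * c l, σ, hσ, by simp [← hc, Finset.mul_sum],
    by simp [hV, Finset.smul_sum, smul_smul]⟩

lemma add (h : IsSwapCombination q s V) (h' : IsSwapCombination q s' V') :
    IsSwapCombination q (s + s') (V + V') := by
  obtain ⟨L, _, c, σ, hσ, hc, hV⟩ := h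
  obtain ⟨L', _, c', σ', hσ', hc', hV'⟩ := h'
  refine ⟨L ⊕ L', inferInstance, Sum.elim c c', Sum.elim σ σ', ?_, ?_, ?_⟩
  · rintro (l | l)
    exacts [hσ l, hσ' l]
  · simp [hc, hc']
  · simp [hV, hV']

lemma mul (h : IsSwapCombination q s V) (h' : IsSwapCombination q' s' V') :
    IsSwapCombination (q + q') (s * s') (V * V') := by
  obtain ⟨L, _, c, σ, hσ, hc, hV⟩ := h
  obtain ⟨L', _, c', σ', hσ', hc', hV'⟩ := h'
  refine ⟨L × L', inferInstance, fun l => c l.1 * c' l.2, fun l => σ l.1 * σ' l.2, ?_, ?_, ?_⟩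
  · intro l
    rw [pow_add]
    exact Set.mul_mem_mul (hσ _) (hσ' _)
  · simp [← hc, ← hc', Finset.sum_mul_sum, Fintype.sum_prod_type]
  · simp only [hV, hV', Finset.sum_mul_sum, Fintype.sum_prod_type, permOp_mul, smul_mul_smul_comm]

lemma pow (h : IsSwapCombination q s V) (j : ℕ) : IsSwapCombination (j * q) (s ^ j) (V ^ j) := by
  induction j with
  | zero => simpa using one
  | succ j ih =>
    rw [pow_succ, pow_succ, add_mul, one_mul]
    exact ih.mul h

lemma sum_range {N : ℕ} {s : ℕ → ℝ} {V : ℕ → Matrix (Config n d) (Config n d) ℂ}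
    (h : ∀ j < N, IsSwapCombination q (s j) (V j)) :
    IsSwapCombination q (∑ j ∈ Finset.range N, s j) (∑ j ∈ Finset.range N, V j) := by
  induction N with
  | zero => simpa using zero q
  | succ N ih =>
    rw [Finset.sum_range_succ, Finset.sum_range_succ]
    exact (ih fun j hj => h j (by omega)).add (h N (by omega))

/-- Adding `δ - δ` to a linear combination raises its total modulus. -/
lemma pad [NeZero n] (h : IsSwapCombination q s V) (hs : s ≤ s') : IsSwapCombination q s' V := by
  have h1 : IsSwapCombination q 1 (1 : Matrix (Config n d) (Config n d) ℂ) :=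
    one.mono (Nat.zero_le _)
  have := (h.add (h1.smul (((s' - s) / 2 : ℝ) : ℂ))).add (h1.smul (-((s' - s) / 2 : ℝ) : ℂ))
  convert this using 1
  · rw [norm_neg, Complex.norm_real, Real.norm_of_nonneg (by linarith)]; ring
  · simp

end IsSwapCombination

lemma norm_le_one_of_conjTranspose_mul_self {ι κ : Type*} [Fintype ι] [Fintype κ] [DecidableEq κ]
    {M : Matrix ι κ ℂ} (h : M.conjTranspose * M = 1) : ‖M‖ ≤ 1 := by
  have h1 : ‖(1 : Matrix κ κ ℂ)‖ ≤ 1 := by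
    rw [← Matrix.diagonal_one, Matrix.l2_opNorm_diagonal]
    exact (pi_norm_le_iff_of_nonneg zero_le_one).2 fun _ => by simp
  rw [← h, Matrix.l2_opNorm_conjTranspose_mul_self] at h1
  nlinarith [norm_nonneg M]

lemma norm_permOp_le {n d : ℕ} (σ : Equiv.Perm (Fin n)) : ‖permOp d σ‖ ≤ 1 := by
  refine norm_le_one_of_conjTranspose_mul_self ?_
  rw [permOp_conjTranspose, ← permOp_mul, inv_mul_cancel, permOp_one]

lemma IsSwapCombination.norm_le {n d : ℕ} {q : ℕ} {s : ℝ} {V : Matrix (Config n d) (Config n d) ℂ}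
    (h : IsSwapCombination q s V) : ‖V‖ ≤ s := by
  obtain ⟨L, _, c, σ, -, rfl, rfl⟩ := h
  refine (norm_sum_le _ _).trans (Finset.sum_le_sum fun l _ => ?_)
  rw [norm_smul]
  exact mul_le_of_le_one_right (norm_nonneg _) (norm_permOp_le _)

/-- A `k`-local element of `ℂ[S_n]` has at most `n ^ k` nonzero coefficients, and its permutations
are products of `k` transpositions. -/
lemma IsLocal.isSwapCombination {n d k : ℕ} [NeZero n] {f : MonoidAlgebra ℂ (Equiv.Perm (Fin n))}
    (hf : IsLocal k f) :
    ∃ s ≤ maxCoeff f * (n : ℝ) ^ k, IsSwapCombination k s (piTilde d f) := by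
  have hmem : ∀ σ : Equiv.Perm (Fin n), σ ∈ (Finset.univ.filter fun σ : Equiv.Perm (Fin n) =>
      σ.support.card ≤ k) ↔ σ.support.card ≤ k := fun σ => by simp
  refine ⟨∑ σ : {σ : Equiv.Perm (Fin n) // σ.support.card ≤ k}, ‖f.coeff σ‖, ?_,
    {σ : Equiv.Perm (Fin n) // σ.support.card ≤ k}, inferInstance, fun σ => f.coeff σ,
    fun σ => σ, fun σ => mem_swapSet_pow_of_card_support_le σ.2, rfl, ?_⟩
  · have hb : ∀ σ, ‖f.coeff σ‖ ≤ maxCoeff f := fun σ =>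
      le_ciSup (f := fun σ => ‖f.coeff σ‖) (Set.finite_range _).bddAbove σ
    have h0 : 0 ≤ maxCoeff f := (norm_nonneg _).trans (hb 1)
    rw [← Finset.sum_subtype _ hmem fun σ => ‖f.coeff σ‖]
    refine (Finset.sum_le_card_nsmul _ _ _ fun σ _ => hb σ).trans ?_
    rw [nsmul_eq_mul, mul_comm]
    gcongr
    exact_mod_cast card_filter_card_support_le (NeZero.one_le) k
  · unfold piTilde
    rw [← Finset.sum_subtype _ hmem fun σ => f.coeff σ • permOp d σ]
    symm
    refine Finset.sum_subset (Finset.subset_univ _) fun σ _ hσ => ?_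
    rw [not_not.1 (mt (hf σ) (by simpa using hσ)), zero_smul]

/-! ### Circuits -/

lemma Circuit.toMatrix_append {n m d : ℕ} (c c' : Circuit n m) :
    Circuit.toMatrix d (c ++ c') = Circuit.toMatrix d c' * Circuit.toMatrix d c := by
  induction c with
  | nil => simp [Circuit.toMatrix]
  | cons g c ih =>
    change Circuit.toMatrix d (c ++ c') * g.toMatrix d = _ * (Circuit.toMatrix d c * g.toMatrix d)
    rw [ih, mul_assoc]

lemma Circuit.swapCount_append {n m : ℕ} (c c' : Circuit n m) :
    Circuit.swapCount (c ++ c') = Circuit.swapCount c + Circuit.swapCount c' := by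
  induction c with
  | nil => simp [Circuit.swapCount]
  | cons g c ih => cases g <;> simp [Circuit.swapCount, ih]; omega

lemma Circuit.toMatrix_singleton {n m d : ℕ} (g : Gate n m) :
    Circuit.toMatrix d [g] = g.toMatrix d := by simp [Circuit.toMatrix]

/-- The inverse gate. -/
def Gate.inv {n m : ℕ} : Gate n m → Gate n m
  | .ancilla U => .ancilla U⁻¹
  | .swap i j => .swap i j

lemma Gate.toMatrix_inv {n m d : ℕ} (g : Gate n m) :
    g.inv.toMatrix d = (g.toMatrix d).conjTranspose := by
  cases g with
  | ancilla U =>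
    simp only [Gate.inv, Gate.toMatrix, Matrix.conjTranspose_kronecker, Matrix.conjTranspose_one]
    rfl
  | swap i j =>
    simp [Gate.inv, Gate.toMatrix, Matrix.blockDiagonal_conjTranspose, permOp_conjTranspose]

lemma Gate.conjTranspose_mul_self {n m d : ℕ} (g : Gate n m) :
    (g.toMatrix d).conjTranspose * g.toMatrix d = 1 := by
  cases g with
  | ancilla U =>
    have : (U : Matrix (Anc m) (Anc m) ℂ).conjTranspose * (U : Matrix (Anc m) (Anc m) ℂ) = 1 :=
      Matrix.mem_unitaryGroup_iff'.1 U.2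
    simp only [Gate.toMatrix, Matrix.conjTranspose_kronecker, Matrix.conjTranspose_one]
    rw [← Matrix.mul_kronecker_mul, this, one_mul, Matrix.one_kronecker_one]
  | swap i j =>
    simp only [Gate.toMatrix, Matrix.blockDiagonal_conjTranspose, permOp_conjTranspose]
    rw [← Matrix.blockDiagonal_mul]
    simp only [← permOp_mul, Equiv.swap_inv, Equiv.swap_mul_self, permOp_one]
    exact Matrix.blockDiagonal_one

lemma Circuit.conjTranspose_mul_self {n m d : ℕ} (c : Circuit n m) :
    (Circuit.toMatrix d c).conjTranspose * Circuit.toMatrix d c = 1 := by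
  induction c with
  | nil => simp [Circuit.toMatrix]
  | cons g c ih =>
    rw [Circuit.toMatrix, Matrix.conjTranspose_mul, Matrix.mul_assoc,
      ← Matrix.mul_assoc _ _ (g.toMatrix d), ih, Matrix.one_mul, g.conjTranspose_mul_self]

/-- The inverse circuit. -/
def Circuit.inv {n m : ℕ} (c : Circuit n m) : Circuit n m := (c.map Gate.inv).reverse

lemma Circuit.toMatrix_inv {n m d : ℕ} (c : Circuit n m) :
    Circuit.toMatrix d c.inv = (Circuit.toMatrix d c).conjTranspose := by
  induction c with
  | nil => simp [Circuit.inv, Circuit.toMatrix]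
  | cons g c ih =>
    rw [Circuit.inv, List.map_cons, List.reverse_cons, Circuit.toMatrix_append,
      Circuit.toMatrix_singleton, Gate.toMatrix_inv, Circuit.toMatrix, Matrix.conjTranspose_mul]
    congr 1

lemma Circuit.swapCount_inv {n m : ℕ} (c : Circuit n m) :
    Circuit.swapCount c.inv = Circuit.swapCount c := by
  induction c with
  | nil => rfl
  | cons g c ih =>
    rw [Circuit.inv, List.map_cons, List.reverse_cons, Circuit.swapCount_append]
    change Circuit.swapCount (Circuit.inv c) + _ = _
    rw [ih]
    cases g <;> rfl

/-- The circuit that repeats `c` a number of times. -/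
def Circuit.repeat {n m : ℕ} (c : Circuit n m) : ℕ → Circuit n m
  | 0 => []
  | r + 1 => c ++ Circuit.repeat c r

lemma Circuit.toMatrix_repeat {n m d : ℕ} (c : Circuit n m) (r : ℕ) :
    Circuit.toMatrix d (c.repeat r) = Circuit.toMatrix d c ^ r := by
  induction r with
  | zero => rfl
  | succ r ih => rw [Circuit.repeat, Circuit.toMatrix_append, ih, pow_succ]

lemma Circuit.swapCount_repeat {n m : ℕ} (c : Circuit n m) (r : ℕ) :
    Circuit.swapCount (c.repeat r) = r * Circuit.swapCount c := by
  induction r with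
  | zero => simp [Circuit.repeat, Circuit.swapCount]
  | succ r ih => rw [Circuit.repeat, Circuit.swapCount_append, ih]; ring

/-- A permutation selected by the ancillas among products of `q` transpositions costs `q` SWAP
gates. -/
lemma exists_select_circuit {n m : ℕ} (d : ℕ) {q : ℕ} (σ : Anc m → Equiv.Perm (Fin n))
    (hσ : ∀ a, σ a ∈ swapSet n ^ q) :
    ∃ c : Circuit n m, c.swapCount = q ∧
      Circuit.toMatrix d c = Matrix.blockDiagonal fun a => permOp d (σ a) := by
  induction q generalizing σ with
  | zero =>
    have : σ = fun _ => 1 := funext fun a => by simpa using hσ a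
    exact ⟨[], rfl, by simp [this, permOp_one, Circuit.toMatrix, ← Pi.one_def]⟩
  | succ q ih =>
    have : ∀ a, ∃ τ ∈ swapSet n ^ q, ∃ i j, σ a = τ * Equiv.swap i j := by
      intro a
      have := hσ a
      rw [pow_succ] at this
      obtain ⟨τ, hτ, _, ⟨i, j, rfl⟩, h⟩ := this
      exact ⟨τ, hτ, i, j, h.symm⟩
    choose τ hτ i j hij using this
    obtain ⟨c, hc, hM⟩ := ih τ hτ
    refine ⟨.swap i j :: c, by simp [Circuit.swapCount, hc], ?_⟩
    rw [Circuit.toMatrix, hM, Gate.toMatrix, ← Matrix.blockDiagonal_mul]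
    simp [hij, permOp_mul]

/-! ### Preparing ancilla states -/

/-- Every unit vector is the image of `e_a` under a unitary matrix. -/
lemma exists_unitary_apply_eq {ι : Type*} [Fintype ι] [DecidableEq ι] (a : ι) (u : ι → ℂ)
    (hu : ∑ i, ‖u i‖ ^ 2 = 1) :
    ∃ U : Matrix.unitaryGroup ι ℂ, ∀ i, (U : Matrix ι ι ℂ) i a = u i := by
  have hn : ‖(WithLp.toLp 2 u : EuclideanSpace ℂ ι)‖ = 1 := by
    rw [EuclideanSpace.norm_eq, Real.sqrt_eq_one]
    exact hu
  obtain ⟨b, hb⟩ := Orthonormal.exists_orthonormalBasis_extension_of_card_eq (𝕜 := ℂ)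
    (E := EuclideanSpace ℂ ι) (ι := ι) (by simp)
    (v := fun _ => WithLp.toLp 2 u) (s := {a}) (by
      constructor
      · intro i; exact hn
      · intro i j hij; exact absurd (Subsingleton.elim i j) hij)
  refine ⟨⟨(EuclideanSpace.basisFun ι ℂ).toBasis.toMatrix b,
    (EuclideanSpace.basisFun ι ℂ).toMatrix_orthonormalBasis_mem_unitary b⟩, fun i => ?_⟩
  simp [Module.Basis.toMatrix_apply, hb a rfl]

/-- The isometry `v ↦ v ⊗ |0⟩` as a matrix. -/
def zeroAnc (n d m : ℕ) : Matrix (Config n d × Anc m) (Config n d) ℂ :=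
  (1 : Matrix (Config n d × Anc m) (Config n d × Anc m) ℂ).submatrix id fun x => (x, 0)

lemma zeroAnc_conjTranspose_mul_mul {n d m : ℕ}
    (M : Matrix (Config n d × Anc m) (Config n d × Anc m) ℂ) :
    (zeroAnc n d m).conjTranspose * M * zeroAnc n d m =
      M.submatrix (fun x => (x, 0)) fun x => (x, 0) := by
  ext x y
  simp [zeroAnc, Matrix.mul_apply, Matrix.one_apply]

lemma zeroAnc_conjTranspose_mul_self {n d m : ℕ} :
    (zeroAnc n d m).conjTranspose * zeroAnc n d m = 1 := by
  have := zeroAnc_conjTranspose_mul_mul (n := n) (d := d) (m := m) 1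
  rw [Matrix.mul_one] at this
  rw [this]
  ext x y
  simp [Matrix.one_apply]

lemma zeroAnc_mulVec {n d m : ℕ} (v : Config n d → ℂ) :
    (zeroAnc n d m).mulVec v = withZeroAnc m v := by
  ext ⟨x, a⟩
  simp [zeroAnc, Matrix.mulVec, dotProduct, withZeroAnc, Matrix.one_apply, ite_and]

lemma Circuit.amplitude_eq {n m d : ℕ} (c : Circuit n m) (w v : Config n d → ℂ) :
    c.amplitude w v = matrixElement w
      ((zeroAnc n d m).conjTranspose * Circuit.toMatrix d c * zeroAnc n d m) v := by
  rw [Circuit.amplitude, matrixElement, matrixElement, ← zeroAnc_mulVec, ← zeroAnc_mulVec,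
    Matrix.star_mulVec, ← Matrix.dotProduct_mulVec, Matrix.mulVec_mulVec, Matrix.mulVec_mulVec,
    Matrix.mul_assoc]

/-! ### Linear combinations of unitaries -/

/-- A linear combination of total modulus `2` is block-encoded, up to the factor `1 / 2`, by
preparing the amplitudes `√(‖c_l‖ / 2)`, with phases, in the ancillas, selecting the permutation
and undoing the preparation without phases. -/
lemma IsSwapCombination.exists_circuit {n d q : ℕ} {V : Matrix (Config n d) (Config n d) ℂ}
    [NeZero n] (h : IsSwapCombination q 2 V) :
    ∃ (m : ℕ) (c : Circuit n m), c.swapCount = q ∧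
      (zeroAnc n d m).conjTranspose * Circuit.toMatrix d c * zeroAnc n d m = (2⁻¹ : ℂ) • V := by
  obtain ⟨L, _, c, σ, hσ, hc, hV⟩ := h
  obtain ⟨m, ⟨e⟩⟩ : ∃ m, Nonempty (L ↪ Anc m) := by
    refine ⟨Fintype.card L, Function.Embedding.nonempty_of_card_le ?_⟩
    simpa using Nat.lt_two_pow_self.le
  have hsum : ∀ {M : Type} [AddCommMonoid M] (g : Anc m → M), (∀ a, a ∉ Set.range e → g a = 0) →
      ∑ a, g a = ∑ l, g (e l) := fun g hg =>
    (Finset.sum_of_injOn e e.injective.injOn (by simp) (fun a _ ha => hg a (by simpa using ha))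
      (fun _ _ => rfl)).symm
  -- For `c l = 0` the quotient below is `0 / 0 = 0`, as it should be.
  set u : Anc m → ℂ := Function.extend e (fun l => c l / (√(2 * ‖c l‖) : ℝ)) 0 with hu
  set w : Anc m → ℂ := Function.extend e (fun l => (√(‖c l‖ / 2) : ℝ)) 0 with hw
  set τ : Anc m → Equiv.Perm (Fin n) := Function.extend e σ 1 with hτ
  have hu' : ∀ l, u (e l) = c l / (√(2 * ‖c l‖) : ℝ) := fun l => e.injective.extend_apply _ _ l
  have hw' : ∀ l, w (e l) = (√(‖c l‖ / 2) : ℝ) := fun l => e.injective.extend_apply _ _ l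
  have hτ' : ∀ l, τ (e l) = σ l := fun l => e.injective.extend_apply _ _ l
  have hu0 : ∀ a, a ∉ Set.range e → u a = 0 := fun a ha => Function.extend_apply' _ _ _ ha
  have hw0 : ∀ a, a ∉ Set.range e → w a = 0 := fun a ha => Function.extend_apply' _ _ _ ha
  have hτq : ∀ a, τ a ∈ swapSet n ^ q := by
    intro a
    by_cases ha : a ∈ Set.range e
    · obtain ⟨l, rfl⟩ := ha
      rw [hτ']; exact hσ l
    · rw [hτ, Function.extend_apply' _ _ _ ha, Pi.one_apply]
      exact one_mem_swapSet_pow q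
  have hun : ∑ a, ‖u a‖ ^ 2 = 1 := by
    rw [hsum _ fun a ha => by simp [hu0 a ha]]
    have : ∀ l, ‖u (e l)‖ ^ 2 = ‖c l‖ / 2 := by
      intro l
      rw [hu', norm_div, Complex.norm_real, Real.norm_of_nonneg (Real.sqrt_nonneg _), div_pow,
        Real.sq_sqrt (by positivity)]
      rcases eq_or_ne ‖c l‖ 0 with h0 | h0
      · simp [h0]
      · field_simp
    rw [Finset.sum_congr rfl fun l _ => this l, ← Finset.sum_div, hc]
    norm_num
  have hwn : ∑ a, ‖w a‖ ^ 2 = 1 := by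
    rw [hsum _ fun a ha => by simp [hw0 a ha]]
    have : ∀ l, ‖w (e l)‖ ^ 2 = ‖c l‖ / 2 := by
      intro l
      rw [hw', Complex.norm_real, Real.norm_of_nonneg (Real.sqrt_nonneg _),
        Real.sq_sqrt (by positivity)]
    rw [Finset.sum_congr rfl fun l _ => this l, ← Finset.sum_div, hc]
    norm_num
  have huw : ∀ l, star (w (e l)) * u (e l) = 2⁻¹ * c l := by
    intro l
    rw [hu', hw']
    rcases eq_or_ne (c l) 0 with h0 | h0
    · simp [h0]
    · have hp : 0 < ‖c l‖ := norm_pos_iff.2 h0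
      have hs : √(2 * ‖c l‖) = 2 * √(‖c l‖ / 2) := by
        rw [show 2 * ‖c l‖ = 2 ^ 2 * (‖c l‖ / 2) by ring, Real.sqrt_mul (by positivity),
          Real.sqrt_sq (by norm_num)]
      have hs0 : ((√(‖c l‖ / 2) : ℝ) : ℂ) ≠ 0 := by
        rw [Complex.ofReal_ne_zero]; positivity
      rw [hs, Complex.star_def, Complex.conj_ofReal, Complex.ofReal_mul]
      push_cast
      field_simp
  obtain ⟨P, hP⟩ := exists_unitary_apply_eq (0 : Anc m) u hun
  obtain ⟨Q, hQ⟩ := exists_unitary_apply_eq (0 : Anc m) w hwn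
  obtain ⟨S, hSc, hS⟩ := exists_select_circuit d τ hτq
  refine ⟨m, [.ancilla P] ++ S ++ [.ancilla Q⁻¹], ?_, ?_⟩
  · simp [Circuit.swapCount_append, Circuit.swapCount, hSc]
  · rw [Circuit.toMatrix_append, Circuit.toMatrix_append, Circuit.toMatrix_singleton,
      Circuit.toMatrix_singleton, zeroAnc_conjTranspose_mul_mul, hS]
    have hQ' : ∀ a, ((Q⁻¹ : Matrix.unitaryGroup (Anc m) ℂ) : Matrix (Anc m) (Anc m) ℂ) 0 a =
        star (w a) := fun a => by
      rw [← hQ a]; rfl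
    ext x y
    have h1 : ((Gate.ancilla Q⁻¹ : Gate n m).toMatrix d *
        (Matrix.blockDiagonal (fun a => permOp d (τ a)) * (Gate.ancilla P : Gate n m).toMatrix d))
          (x, 0) (y, 0) = ∑ a, star (w a) * u a * permOp d (τ a) x y := by
      rw [Matrix.mul_apply, Fintype.sum_prod_type_right]
      refine Finset.sum_congr rfl fun a _ => ?_
      rw [Finset.sum_eq_single x]
      · rw [Matrix.mul_apply, Fintype.sum_prod_type_right, Finset.sum_eq_single a]
        · rw [Finset.sum_eq_single y]
          · simp only [Gate.toMatrix, Matrix.kroneckerMap_apply, Matrix.one_apply_eq, one_mul, hQ',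
              hP, Matrix.blockDiagonal_apply_eq]
            ring
          · intro b _ hb
            simp [Gate.toMatrix, hb]
          · simp
        · intro b _ hb
          simp [Matrix.blockDiagonal_apply, hb.symm]
        · simp
      · intro b _ hb
        simp [Gate.toMatrix, hb.symm]
      · simp
    rw [Matrix.submatrix_apply, h1, hsum _ fun a ha => by simp [hu0 a ha], hV]
    simp only [huw, hτ', Matrix.smul_apply, Matrix.sum_apply, smul_eq_mul, Finset.mul_sum,
      mul_assoc]

/-! ### Truncated exponential series -/

lemma norm_exp_sub_sum_range_le {A : Type*} [NormedRing A] [NormedAlgebra ℂ A] [CompleteSpace A]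
    {X : A} (hX : ‖X‖ ≤ 1) {N : ℕ} (hN : 0 < N) :
    ‖NormedSpace.exp X - ∑ j ∈ Finset.range N, ((j ! : ℂ)⁻¹) • X ^ j‖ ≤ 2 / N ! := by
  have h1 : HasSum (fun j : ℕ => ((j ! : ℂ)⁻¹) • X ^ j) (NormedSpace.exp X) :=
    NormedSpace.exp_series_hasSum_exp' (𝕂 := ℂ) X
  have h2 : HasSum (fun j : ℕ => ‖X‖ ^ j / (j ! : ℝ)) (Real.exp ‖X‖) := by
    rw [Real.exp_eq_exp_ℝ]
    exact NormedSpace.expSeries_div_hasSum_exp ‖X‖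
  have h1' := (hasSum_nat_add_iff' N).2 h1
  have h2' := (hasSum_nat_add_iff' N).2 h2
  rw [← h1'.tsum_eq]
  refine (tsum_of_norm_bounded h2' fun j => ?_).trans ?_
  · rw [norm_smul, norm_inv, Complex.norm_natCast, div_eq_inv_mul]
    gcongr
    exact norm_pow_le' X (by omega)
  · have h := Real.exp_bound' (norm_nonneg X) hX hN
    have hN' : (1 : ℝ) ≤ N := by exact_mod_cast hN
    have hf : (0 : ℝ) < N ! := by positivity
    have hp : ‖X‖ ^ N ≤ 1 := pow_le_one₀ (norm_nonneg X) hX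
    have : ‖X‖ ^ N * (N + 1) / (N ! * N) ≤ 2 / N ! := by
      rw [div_le_div_iff₀ (by positivity) hf]
      have : ‖X‖ ^ N * (N + 1) ≤ 2 * N := by nlinarith
      nlinarith
    linarith

/-! ### Oblivious amplitude amplification -/

/-- For a block encoding `W` of `B`, the product `-W R Wᴴ R W` with the reflection
`R = 1 - 2 J Jᴴ` is a block encoding of `3 B - 4 B Bᴴ B`. -/
lemma amplification_identity {ι κ : Type*} [Fintype ι] [Fintype κ] [DecidableEq ι] [DecidableEq κ]
    {J : Matrix ι κ ℂ} {W : Matrix ι ι ℂ} (hJ : J.conjTranspose * J = 1)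
    (hW : W.conjTranspose * W = 1) :
    J.conjTranspose * (W * -(1 - (2 : ℂ) • (J * J.conjTranspose)) * W.conjTranspose *
        (1 - (2 : ℂ) • (J * J.conjTranspose)) * W) * J =
      (3 : ℂ) • (J.conjTranspose * W * J) - (4 : ℂ) • ((J.conjTranspose * W * J) *
        (J.conjTranspose * W * J).conjTranspose * (J.conjTranspose * W * J)) := by
  have hW' : W * W.conjTranspose = 1 := mul_eq_one_comm.1 hW
  have e1 : ∀ M : Matrix κ κ ℂ, J.conjTranspose * (J * M) = M := fun M => by
    rw [← Matrix.mul_assoc, hJ, Matrix.one_mul]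
  have e2 : ∀ M : Matrix ι κ ℂ, W.conjTranspose * (W * M) = M := fun M => by
    rw [← Matrix.mul_assoc, hW, Matrix.one_mul]
  have e3 : ∀ M : Matrix ι κ ℂ, W * (W.conjTranspose * M) = M := fun M => by
    rw [← Matrix.mul_assoc, hW', Matrix.one_mul]
  simp only [Matrix.conjTranspose_mul, Matrix.conjTranspose_conjTranspose, neg_sub, Matrix.mul_sub,
    Matrix.sub_mul, Matrix.mul_one, Matrix.mul_smul, Matrix.smul_mul, hJ, e1, e2, e3,
    Matrix.mul_assoc]
  module

/-- With `B = V / 2` the amplified block is `(3 V - V Vᴴ V) / 2`, which fixes unitaries. -/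
lemma norm_amplification_sub_le {κ : Type*} [Fintype κ] [DecidableEq κ] {V E : Matrix κ κ ℂ}
    (hE : E.conjTranspose * E = 1) (hV : ‖V‖ ≤ 2) :
    ‖(3 : ℂ) • ((2⁻¹ : ℂ) • V) - (4 : ℂ) • (((2⁻¹ : ℂ) • V) * ((2⁻¹ : ℂ) • V).conjTranspose *
      ((2⁻¹ : ℂ) • V)) - E‖ ≤ 5 * ‖V - E‖ := by
  have hE1 : ‖E‖ ≤ 1 := norm_le_one_of_conjTranspose_mul_self hE
  have h : (3 : ℂ) • ((2⁻¹ : ℂ) • V) - (4 : ℂ) • (((2⁻¹ : ℂ) • V) *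
        ((2⁻¹ : ℂ) • V).conjTranspose * ((2⁻¹ : ℂ) • V)) - E =
      (3 / 2 : ℂ) • (V - E) - (1 / 2 : ℂ) • ((V - E) * V.conjTranspose * V +
        E * (V - E).conjTranspose * V + E * E.conjTranspose * (V - E)) := by
    have h3 : E * E.conjTranspose = 1 := mul_eq_one_comm.1 hE
    simp only [Matrix.conjTranspose_smul, Matrix.conjTranspose_sub, Matrix.mul_sub, Matrix.sub_mul,
      Matrix.smul_mul, Matrix.mul_smul, h3, Matrix.one_mul, star_inv₀, star_ofNat]
    module
  have hm : ∀ {a b c : ℝ} {X Y Z : Matrix κ κ ℂ}, ‖X‖ ≤ a → ‖Y‖ ≤ b → ‖Z‖ ≤ c →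
      ‖X * Y * Z‖ ≤ a * b * c := by
    intro a b c X Y Z hX hY hZ
    have ha := (norm_nonneg _).trans hX
    have hb := (norm_nonneg _).trans hY
    refine (Matrix.l2_opNorm_mul _ _).trans ?_
    gcongr
    exact (Matrix.l2_opNorm_mul _ _).trans (by gcongr)
  have h1 := hm (le_refl ‖V - E‖) ((Matrix.l2_opNorm_conjTranspose V).le.trans hV) hV
  have h2 := hm hE1 (Matrix.l2_opNorm_conjTranspose (V - E)).le hV
  have h3 := hm hE1 ((Matrix.l2_opNorm_conjTranspose E).le.trans hE1) (le_refl ‖V - E‖)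
  rw [h]
  refine (norm_sub_le _ _).trans ?_
  rw [norm_smul, norm_smul, show ‖(3 / 2 : ℂ)‖ = 3 / 2 by norm_num,
    show ‖(1 / 2 : ℂ)‖ = 1 / 2 by norm_num]
  have h4 := norm_add₃_le (a := (V - E) * V.conjTranspose * V)
    (b := E * (V - E).conjTranspose * V) (c := E * E.conjTranspose * (V - E))
  linarith

/-! ### Iterating a block encoding -/

/-- If the block of a unitary `G` is close to a unitary `E`, then little amplitude leaves the
block: `(G J - J E)ᴴ (G J - J E)` is linear in `Jᴴ G J - E`. -/
lemma sq_norm_mul_sub_mul_le {ι κ : Type*} [Fintype ι] [Fintype κ] [DecidableEq ι] [DecidableEq κ]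
    {J : Matrix ι κ ℂ} {G : Matrix ι ι ℂ} {E : Matrix κ κ ℂ} (hJ : J.conjTranspose * J = 1)
    (hG : G.conjTranspose * G = 1) (hE : E.conjTranspose * E = 1) :
    ‖G * J - J * E‖ ^ 2 ≤ 2 * ‖J.conjTranspose * G * J - E‖ := by
  have hE1 : ‖E‖ ≤ 1 := norm_le_one_of_conjTranspose_mul_self hE
  set B := J.conjTranspose * G * J with hB
  have h : (G * J - J * E).conjTranspose * (G * J - J * E) =
      -((B - E).conjTranspose * E + E.conjTranspose * (B - E)) := by
    have e1 : ∀ M : Matrix κ κ ℂ, J.conjTranspose * (J * M) = M := fun M => by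
      rw [← Matrix.mul_assoc, hJ, Matrix.one_mul]
    have e2 : ∀ M : Matrix ι κ ℂ, G.conjTranspose * (G * M) = M := fun M => by
      rw [← Matrix.mul_assoc, hG, Matrix.one_mul]
    simp only [hB, Matrix.conjTranspose_mul, Matrix.conjTranspose_sub, Matrix.mul_sub,
      Matrix.sub_mul, Matrix.mul_assoc, e1, e2, hJ, hE, Matrix.conjTranspose_conjTranspose]
    abel
  rw [sq, ← Matrix.l2_opNorm_conjTranspose_mul_self, h, norm_neg]
  refine (norm_add_le _ _).trans ?_
  have h1 := Matrix.l2_opNorm_mul (B - E).conjTranspose E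
  have h2 := Matrix.l2_opNorm_mul E.conjTranspose (B - E)
  rw [Matrix.l2_opNorm_conjTranspose] at h1 h2
  have h3 : ‖B - E‖ * ‖E‖ ≤ ‖B - E‖ := mul_le_of_le_one_right (norm_nonneg _) hE1
  linarith [mul_comm ‖E‖ ‖B - E‖]

/-- The errors of consecutive steps add up, although all steps use the same ancillas. -/
lemma norm_block_pow_sub_pow_le {ι κ : Type*} [Fintype ι] [Fintype κ] [DecidableEq ι]
    [DecidableEq κ] {J : Matrix ι κ ℂ} {G : Matrix ι ι ℂ} {E : Matrix κ κ ℂ}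
    (hJ : J.conjTranspose * J = 1) (hG : G.conjTranspose * G = 1) (hE : E.conjTranspose * E = 1)
    (r : ℕ) :
    ‖J.conjTranspose * G ^ r * J - E ^ r‖ ≤ r * ‖G * J - J * E‖ := by
  have hE1 : ‖E‖ ≤ 1 := norm_le_one_of_conjTranspose_mul_self hE
  have hJ1 : ‖J.conjTranspose‖ ≤ 1 := by
    rw [Matrix.l2_opNorm_conjTranspose]; exact norm_le_one_of_conjTranspose_mul_self hJ
  have hGr : ∀ r : ℕ, ‖G ^ r‖ ≤ 1 := by
    intro r
    refine norm_le_one_of_conjTranspose_mul_self ?_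
    induction r with
    | zero => simp
    | succ r ih =>
      rw [pow_succ, Matrix.conjTranspose_mul, Matrix.mul_assoc, ← Matrix.mul_assoc _ _ G, ih,
        Matrix.one_mul, hG]
  have key : ∀ r : ℕ, ‖G ^ r * J - J * E ^ r‖ ≤ r * ‖G * J - J * E‖ := by
    intro r
    induction r with
    | zero => simp
    | succ r ih =>
      have : G ^ (r + 1) * J - J * E ^ (r + 1) =
          G ^ r * (G * J - J * E) + (G ^ r * J - J * E ^ r) * E := by
        simp only [pow_succ, Matrix.mul_sub, Matrix.sub_mul, Matrix.mul_assoc]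
        abel
      rw [this]
      refine (norm_add_le _ _).trans ?_
      have h1 := (Matrix.l2_opNorm_mul (G ^ r) (G * J - J * E)).trans
        (mul_le_of_le_one_left (norm_nonneg _) (hGr r))
      have h2 := (Matrix.l2_opNorm_mul (G ^ r * J - J * E ^ r) E).trans
        (mul_le_of_le_one_right (norm_nonneg _) hE1)
      push_cast
      linarith
  have : J.conjTranspose * G ^ r * J - E ^ r = J.conjTranspose * (G ^ r * J - J * E ^ r) := by
    rw [Matrix.mul_sub, ← Matrix.mul_assoc, ← Matrix.mul_assoc, hJ, Matrix.one_mul]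
  rw [this]
  exact ((Matrix.l2_opNorm_mul _ _).trans (mul_le_of_le_one_left (norm_nonneg _) hJ1)).trans (key r)

lemma norm_matrixElement_le {ι : Type} [Fintype ι] [DecidableEq ι] {v w : ι → ℂ}
    (hv : star v ⬝ᵥ v = 1) (hw : star w ⬝ᵥ w = 1) (A : Matrix ι ι ℂ) :
    ‖matrixElement w A v‖ ≤ ‖A‖ := by
  have hn : ∀ {u : ι → ℂ}, star u ⬝ᵥ u = 1 → ‖(WithLp.toLp 2 u : EuclideanSpace ℂ ι)‖ = 1 := by
    intro u hu
    have h := inner_self_eq_norm_sq (𝕜 := ℂ) (WithLp.toLp 2 u : EuclideanSpace ℂ ι)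
    rw [EuclideanSpace.inner_eq_star_dotProduct, dotProduct_comm, hu, RCLike.one_re] at h
    nlinarith [norm_nonneg (WithLp.toLp 2 u : EuclideanSpace ℂ ι)]
  have h1 := norm_inner_le_norm (𝕜 := ℂ) (WithLp.toLp 2 w : EuclideanSpace ℂ ι)
    (WithLp.toLp 2 (A.mulVec v))
  rw [EuclideanSpace.inner_eq_star_dotProduct, dotProduct_comm, hn hw, one_mul] at h1
  have h2 := Matrix.l2_opNorm_mulVec A (WithLp.toLp 2 v)
  rw [hn hv, mul_one] at h2
  exact h1.trans h2

/-! ### The order of truncation -/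

/-- A truncation order of about `16 L / log L` makes the factorial as large as `exp (8 L)`. -/
lemma exists_factorial_ge {L : ℝ} (hL : 1 < L) :
    ∃ N : ℕ, 0 < N ∧ Real.exp (8 * L) ≤ N ! ∧ (N : ℝ) ≤ 17 * (L / Real.log L) := by
  set l := Real.log L with hl
  have hl0 : 0 < l := Real.log_pos hL
  set M := L / l with hM
  have hM1 : 1 ≤ M := by
    rw [hM, le_div_iff₀ hl0]; linarith [Real.log_le_sub_one_of_pos (by linarith : 0 < L)]
  refine ⟨⌈16 * M⌉₊, Nat.ceil_pos.2 (by linarith), ?_, ?_⟩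
  · set N := ⌈16 * M⌉₊
    have hN : 16 * M ≤ N := Nat.le_ceil _
    have hN0 : (0 : ℝ) < N := by linarith
    -- `N! ≥ (N / e) ^ N`, and `log (N / e) ≥ l / 2`.
    have h1 := Real.pow_div_factorial_le_exp (N : ℝ) hN0.le N
    rw [div_le_iff₀ (by positivity)] at h1
    have hlogM : Real.log M = l - Real.log l := by
      rw [hM, Real.log_div (by linarith) hl0.ne']
    have hlogl : Real.log l ≤ l / 2 := by
      have := Real.log_le_sub_one_of_pos (half_pos hl0)
      rw [Real.log_div hl0.ne' two_ne_zero] at this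
      linarith [Real.log_two_lt_d9]
    have hlog16 : 1 ≤ Real.log 16 := by
      rw [Real.le_log_iff_exp_le (by norm_num)]; linarith [Real.exp_one_lt_d9]
    have hlogN : 1 + l / 2 ≤ Real.log N := by
      have := Real.log_le_log (by positivity) hN
      rw [Real.log_mul (by norm_num) (by positivity)] at this
      linarith
    have h2 : 8 * L + N ≤ N * Real.log N := by
      have hMl : M * l = L := div_mul_cancel₀ L hl0.ne'
      nlinarith
    have h3 : Real.exp (8 * L) * Real.exp N ≤ (N : ℝ) ^ N := by
      rw [← Real.exp_add, ← Real.rpow_natCast, Real.rpow_def_of_pos hN0]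
      exact Real.exp_le_exp.2 (by linarith)
    have h4 := h3.trans h1
    rw [mul_comm (Real.exp N)] at h4
    exact le_of_mul_le_mul_right h4 (Real.exp_pos _)
  · have := Nat.ceil_lt_add_one (by linarith : 0 ≤ 16 * M)
    linarith

/-! ### Simulating the evolution -/

/-- The reflection `1 - 2 |0⟩⟨0|` of the ancilla register. -/
def ancReflection (m : ℕ) : Matrix.unitaryGroup (Anc m) ℂ :=
  ⟨Matrix.diagonal fun a => if a = 0 then -1 else 1, by
    rw [Matrix.mem_unitaryGroup_iff, Matrix.star_eq_conjTranspose, Matrix.diagonal_conjTranspose,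
      Matrix.diagonal_mul_diagonal, ← Matrix.diagonal_one]
    congr 1
    ext a
    by_cases h : a = 0 <;> simp [h]⟩

lemma toMatrix_ancReflection {n d m : ℕ} :
    (Gate.ancilla (ancReflection m) : Gate n m).toMatrix d =
      1 - (2 : ℂ) • (zeroAnc n d m * (zeroAnc n d m).conjTranspose) := by
  ext ⟨x, a⟩ ⟨y, b⟩
  have h : (zeroAnc n d m * (zeroAnc n d m).conjTranspose) (x, a) (y, b) =
      if x = y ∧ a = 0 ∧ b = 0 then 1 else 0 := by
    rw [Matrix.mul_apply, Finset.sum_eq_single x]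
    · rcases eq_or_ne x y with rfl | hx <;> by_cases ha : a = 0 <;> by_cases hb : b = 0 <;>
        simp [zeroAnc, Matrix.one_apply, *, Ne.symm]
    · intro z _ hz
      simp [zeroAnc, Matrix.one_apply, hz.symm]
    · simp
  rw [Matrix.sub_apply, Matrix.smul_apply, h]
  by_cases hx : x = y <;> by_cases ha : a = 0 <;> by_cases hb : b = 0 <;>
    by_cases hab : a = b <;>
    simp_all [Gate.toMatrix, ancReflection, Matrix.one_apply]
  norm_num

lemma toMatrix_neg_ancReflection {n d m : ℕ} :
    (Gate.ancilla (-ancReflection m) : Gate n m).toMatrix d =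
      -(1 - (2 : ℂ) • (zeroAnc n d m * (zeroAnc n d m).conjTranspose)) := by
  rw [← toMatrix_ancReflection]
  ext ⟨x, a⟩ ⟨y, b⟩
  simp only [Gate.toMatrix, Matrix.kroneckerMap_apply, Matrix.neg_apply]
  exact mul_neg _ _

/-- One step of oblivious amplitude amplification turns a block encoding of `V / 2`, with `V` close
to a unitary `E`, into a block encoding of an operator close to `E`. -/
lemma IsSwapCombination.exists_amplified_circuit {n d q : ℕ} [NeZero n]
    {V E : Matrix (Config n d) (Config n d) ℂ} (h : IsSwapCombination q 2 V)
    (hE : E.conjTranspose * E = 1) :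
    ∃ (m : ℕ) (c : Circuit n m), c.swapCount = 3 * q ∧
      ‖(zeroAnc n d m).conjTranspose * Circuit.toMatrix d c * zeroAnc n d m - E‖ ≤
        5 * ‖V - E‖ := by
  obtain ⟨m, c, hc, hV⟩ := h.exists_circuit
  refine ⟨m, c ++ [.ancilla (ancReflection m)] ++ c.inv ++ [.ancilla (-ancReflection m)] ++ c,
    ?_, ?_⟩
  · simp only [Circuit.swapCount_append, Circuit.swapCount_inv, Circuit.swapCount, hc]
    ring
  · have key : Circuit.toMatrix d (c ++ [.ancilla (ancReflection m)] ++ c.inv ++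
        [.ancilla (-ancReflection m)] ++ c) = Circuit.toMatrix d c *
          -(1 - (2 : ℂ) • (zeroAnc n d m * (zeroAnc n d m).conjTranspose)) *
          (Circuit.toMatrix d c).conjTranspose *
          (1 - (2 : ℂ) • (zeroAnc n d m * (zeroAnc n d m).conjTranspose)) *
          Circuit.toMatrix d c := by
      rw [Circuit.toMatrix_append, Circuit.toMatrix_append, Circuit.toMatrix_append,
        Circuit.toMatrix_append, Circuit.toMatrix_singleton, Circuit.toMatrix_singleton,
        Circuit.toMatrix_inv, toMatrix_ancReflection, toMatrix_neg_ancReflection]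
      simp only [Matrix.mul_assoc]
    rw [key, amplification_identity zeroAnc_conjTranspose_mul_self c.conjTranspose_mul_self, hV]
    exact norm_amplification_sub_le hE h.norm_le

lemma evolution_conjTranspose_mul_self {n d : ℕ} {H : Matrix (Config n d) (Config n d) ℂ}
    (hH : H.IsHermitian) (t : ℝ) : (evolution H t).conjTranspose * evolution H t = 1 := by
  have h : ((-(Complex.I * (t : ℂ))) • H).conjTranspose = -((-(Complex.I * (t : ℂ))) • H) := by
    rw [Matrix.conjTranspose_smul, hH.eq]
    simp
  have hc : Commute (-((-(Complex.I * (t : ℂ))) • H)) ((-(Complex.I * (t : ℂ))) • H) :=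
    (Commute.refl _).neg_left
  rw [evolution, ← Matrix.exp_conjTranspose, h, ← Matrix.exp_add_of_commute _ _ hc, neg_add_cancel,
    NormedSpace.exp_zero]

lemma evolution_pow {n d : ℕ} (H : Matrix (Config n d) (Config n d) ℂ) (t : ℝ) {r : ℕ}
    (hr : r ≠ 0) : evolution H (t / r) ^ r = evolution H t := by
  have hr' : (r : ℂ) ≠ 0 := Nat.cast_ne_zero.2 hr
  rw [evolution, evolution, ← Matrix.exp_nsmul, ← Nat.cast_smul_eq_nsmul ℂ, smul_smul]
  congr 2
  push_cast
  field_simp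

/-- A short evolution: the series truncated after `N` terms has total modulus at most `2`. -/
lemma IsSwapCombination.exists_short_evolution_circuit {n d k : ℕ} [NeZero n] {s : ℝ}
    {H : Matrix (Config n d) (Config n d) ℂ} (h : IsSwapCombination k s H) (hH : H.IsHermitian)
    {t : ℝ} (ht : |t| * s ≤ 1 / 2) {N : ℕ} (hN : 0 < N) :
    ∃ (m : ℕ) (c : Circuit n m), c.swapCount = 3 * (N * k) ∧
      ‖(zeroAnc n d m).conjTranspose * Circuit.toMatrix d c * zeroAnc n d m - evolution H t‖ ≤
        10 / N ! := by
  set X := (-(Complex.I * (t : ℂ))) • H with hX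
  have hXs : IsSwapCombination k (|t| * s) X := by
    have := h.smul (-(Complex.I * (t : ℂ)))
    rwa [norm_neg, norm_mul, Complex.norm_I, one_mul, Complex.norm_real, Real.norm_eq_abs] at this
  have h0 : 0 ≤ |t| * s := (norm_nonneg _).trans hXs.norm_le
  have hV : IsSwapCombination (N * k) 2 (∑ j ∈ Finset.range N, ((j ! : ℂ)⁻¹) • X ^ j) := by
    have h1 : ∀ j < N, IsSwapCombination (N * k) ((|t| * s) ^ j / j !) (((j ! : ℂ)⁻¹) • X ^ j) := by
      intro j hj
      have := ((hXs.pow j).smul ((j ! : ℂ)⁻¹)).mono (Nat.mul_le_mul_right k hj.le)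
      rwa [norm_inv, Complex.norm_natCast, ← div_eq_inv_mul] at this
    refine (IsSwapCombination.sum_range h1).pad ?_
    refine (Real.sum_le_exp_of_nonneg h0 N).trans ((Real.exp_le_exp.2 ht).trans ?_)
    have h2 : Real.exp (1 / 2) ^ 2 = Real.exp 1 := by rw [← Real.exp_nat_mul]; norm_num
    nlinarith [Real.exp_pos (1 / 2), Real.exp_one_lt_d9]
  obtain ⟨m, c, hc, hb⟩ := hV.exists_amplified_circuit (evolution_conjTranspose_mul_self hH t)
  refine ⟨m, c, hc, hb.trans ?_⟩
  have := norm_exp_sub_sum_range_le (X := X) (hXs.norm_le.trans (by linarith)) hN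
  rw [norm_sub_rev, evolution]
  calc _ ≤ 5 * (2 / (N ! : ℝ)) := by gcongr
    _ = _ := by ring

/-- The evolution in `r` equal steps. -/
lemma IsSwapCombination.exists_evolution_circuit {n d k : ℕ} [NeZero n] {s : ℝ}
    {H : Matrix (Config n d) (Config n d) ℂ} (h : IsSwapCombination k s H) (hH : H.IsHermitian)
    {t : ℝ} {r : ℕ} (hr : 0 < r) (ht : |t| * s ≤ r / 2) {N : ℕ} (hN : 0 < N) {ε : ℝ} (hε : 0 ≤ ε)
    (hrε : 20 * (r : ℝ) ^ 2 ≤ ε ^ 2 * N !) :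
    ∃ (m : ℕ) (c : Circuit n m), c.swapCount = r * (3 * (N * k)) ∧
      ‖(zeroAnc n d m).conjTranspose * Circuit.toMatrix d c * zeroAnc n d m - evolution H t‖ ≤
        ε := by
  have hr' : (0 : ℝ) < r := Nat.cast_pos.2 hr
  have ht' : |t / r| * s ≤ 1 / 2 := by
    rw [abs_div, Nat.abs_cast, div_mul_eq_mul_div, div_le_iff₀ hr']
    linarith
  obtain ⟨m, c, hc, hb⟩ := h.exists_short_evolution_circuit hH ht' hN
  refine ⟨m, c.repeat r, by rw [Circuit.swapCount_repeat, hc], ?_⟩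
  have hJ := zeroAnc_conjTranspose_mul_self (n := n) (d := d) (m := m)
  have hE := evolution_conjTranspose_mul_self hH (t / r)
  rw [Circuit.toMatrix_repeat, ← evolution_pow H t hr.ne']
  refine (norm_block_pow_sub_pow_le hJ c.conjTranspose_mul_self hE r).trans ?_
  have h1 := (sq_norm_mul_sub_mul_le hJ c.conjTranspose_mul_self hE).trans
    (mul_le_mul_of_nonneg_left hb zero_le_two)
  refine le_of_sq_le_sq ?_ hε
  rw [mul_pow]
  have hf : (0 : ℝ) < N ! := by positivity
  calc _ ≤ (r : ℝ) ^ 2 * (2 * (10 / N !)) := by gcongr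
    _ = 20 * (r : ℝ) ^ 2 / N ! := by ring
    _ ≤ ε ^ 2 := by rwa [div_le_iff₀ hf]

lemma commute_evolution_piTilde {n d : ℕ} (f : MonoidAlgebra ℂ (Equiv.Perm (Fin n))) (t : ℝ)
    {Z : Matrix (Config n d) (Config n d) ℂ} (hZ : ∀ σ, Commute (permOp d σ) Z) :
    Commute (evolution (piTilde d f) t) Z := by
  refine Commute.exp_left (Commute.smul_left ?_ _)
  exact Commute.sum_left _ _ _ fun σ _ => (hZ σ).smul_left _

end PermQudit

theorem mainTheorem5 :
    ∃ A : ℝ, 0 < A ∧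
      ∀ (n d k : ℕ) (f : MonoidAlgebra ℂ (Equiv.Perm (Fin n))) (t ε : ℝ),
        PermQudit.IsLocal k f →
        (PermQudit.piTilde d f).IsHermitian →
        0 < ε →
        1 ≤ t * PermQudit.maxCoeff f * k * (n : ℝ) ^ k →
        Real.exp 1 < t * PermQudit.maxCoeff f * k * (n : ℝ) ^ k / ε →
        ∃ (m : ℕ) (c : PermQudit.Circuit n m),
          (c.swapCount : ℝ) ≤
            A * (t * PermQudit.maxCoeff f * (k : ℝ) ^ 3 * (n : ℝ) ^ k *
              (Real.log (t * PermQudit.maxCoeff f * k * (n : ℝ) ^ k / ε) /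
                Real.log (Real.log (t * PermQudit.maxCoeff f * k * (n : ℝ) ^ k / ε)))) ∧
          ∀ (T T' : PermQudit.StdTableau n) (v v' : PermQudit.Config n d → ℂ),
            PermQudit.IsYoungVector T v →
            PermQudit.IsYoungVector T' v' →
            ‖c.amplitude v' v -
                PermQudit.matrixElement v' (PermQudit.evolution (PermQudit.piTilde d f) t) v‖ ≤ ε ∧
              (T.shape ≠ T'.shape →
                PermQudit.matrixElement v'
                  (PermQudit.evolution (PermQudit.piTilde d f) t) v = 0) := by
  open PermQudit in
  -- `153 = 3 * 3 * 17`: at most `3 τ` time steps, `3` uses of the block encoding in each, and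
  -- truncation order at most `17 L / log L`.
  refine ⟨153, by norm_num, fun n d k f t ε hf hH hε h1 hx => ?_⟩
  -- The hypothesis `1 ≤ t C k n ^ k` excludes `k = 0`, `n = 0` and `t ≤ 0`.
  have hk : 1 ≤ k := by
    rcases Nat.eq_zero_or_pos k with rfl | hk
    · norm_num at h1
    · exact hk
  have hn : n ≠ 0 := by
    rintro rfl
    rw [Nat.cast_zero, zero_pow (by omega), mul_zero] at h1
    norm_num at h1
  have : NeZero n := ⟨hn⟩
  have hC : 0 ≤ maxCoeff f := Real.iSup_nonneg fun σ => norm_nonneg _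
  have ht : 0 < t := by
    by_contra ht
    have : t * maxCoeff f * k * (n : ℝ) ^ k ≤ 0 := by
      have : 0 ≤ maxCoeff f * (k * (n : ℝ) ^ k) := by positivity
      nlinarith
    linarith
  have hk' : (1 : ℝ) ≤ k := by exact_mod_cast hk
  set τ := t * maxCoeff f * k * (n : ℝ) ^ k with hτ
  have hx0 : 0 < τ / ε := (Real.exp_pos 1).trans hx
  have hL : 1 < Real.log (τ / ε) := (Real.lt_log_iff_exp_lt hx0).2 hx
  obtain ⟨N, hN0, hNf, hN⟩ := exists_factorial_ge hL
  set M := Real.log (τ / ε) / Real.log (Real.log (τ / ε)) with hM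
  obtain ⟨s, hs, hcomb⟩ := hf.isSwapCombination (d := d)
  set r := ⌈2 * τ⌉₊ with hr
  have hr1 : 2 * τ ≤ r := Nat.le_ceil _
  have hr2 : (r : ℝ) ≤ 3 * τ := by
    have := Nat.ceil_lt_add_one (by linarith : 0 ≤ 2 * τ)
    linarith
  have hts : |t| * s ≤ r / 2 := by
    have h2 : t * s ≤ t * (maxCoeff f * (n : ℝ) ^ k) := by gcongr
    have h3 : t * (maxCoeff f * (n : ℝ) ^ k) * 1 ≤ t * (maxCoeff f * (n : ℝ) ^ k) * k := by gcongr
    rw [abs_of_pos ht]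
    have h4 : τ = t * (maxCoeff f * (n : ℝ) ^ k) * k := by rw [hτ]; ring
    linarith
  have hrε : 20 * (r : ℝ) ^ 2 ≤ ε ^ 2 * N.factorial := by
    -- As `r ≤ 3 τ` and `20 * 3 ^ 2 = 180 ≤ e ^ 6 ≤ (τ / ε) ^ 6`, it suffices that `N!` is at least
    -- `(τ / ε) ^ 8`.
    have hx2 : (τ / ε) ^ 2 * 180 ≤ N.factorial := by
      refine le_trans ?_ hNf
      have e1 : Real.exp (8 * Real.log (τ / ε)) = (τ / ε) ^ 8 := by
        rw [mul_comm, Real.exp_mul, Real.exp_log hx0]; norm_cast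
      rw [e1, show (τ / ε) ^ 8 = (τ / ε) ^ 2 * (τ / ε) ^ 6 by ring]
      have h27 : (2.7 : ℝ) ≤ τ / ε := by linarith [Real.exp_one_gt_d9]
      have h6 : (2.7 : ℝ) ^ 6 ≤ (τ / ε) ^ 6 := by gcongr
      have : (180 : ℝ) ≤ 2.7 ^ 6 := by norm_num
      gcongr
      linarith
    calc 20 * (r : ℝ) ^ 2 ≤ 20 * (3 * τ) ^ 2 := by gcongr
      _ = ε ^ 2 * ((τ / ε) ^ 2 * 180) := by field_simp; ring
      _ ≤ _ := by gcongr
  have hr0 : 0 < r := (Nat.cast_pos (α := ℝ)).1 (by linarith)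
  obtain ⟨m, c, hc, hb⟩ := hcomb.exists_evolution_circuit hH hr0 hts hN0 hε.le hrε
  refine ⟨m, c, ?_, fun T T' v v' hv hv' => ⟨?_, fun hT => ?_⟩⟩
  · have hM0 : 0 ≤ M := by
      have : (0 : ℝ) ≤ N := Nat.cast_nonneg N
      linarith
    rw [hc]
    push_cast
    calc (r : ℝ) * (3 * (N * k)) ≤ 3 * τ * (3 * (17 * M * k)) := by gcongr
      _ = 153 * (τ * k * M) * 1 := by ring
      _ ≤ 153 * (τ * k * M) * k := by gcongr
      _ = _ := by rw [hτ]; ring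
  · rw [Circuit.amplitude_eq, matrixElement, matrixElement, ← dotProduct_sub, ← Matrix.sub_mulVec]
    exact (norm_matrixElement_le hv.1 hv'.1 _).trans hb
  · exact matrixElement_eq_zero hv hv' hT fun Z hZ => commute_evolution_piTilde f t hZ
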